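/- Let $\pi:Y\to X$ be a smooth fibred manifold (for example a fibre bundle) over an oriented $n$-dimensional manifold $X$, $n\ge 1$, with a pseudo-Riemannian metric $g$ and its volume form $\omega$. Let $\sigma=\operatorname{sign}\det g=\pm1$, and let $*$ be the Hodge star, so that $*\omega=\sigma$. Let $\bigwedge^p_q$ denote the $p$-forms annihilated by any $q+1$ vertical vectors, and let $Z=\bigwedge^n_1(Y)/\bigwedge^n_0(Y)$ be the extended polymomentum phase space, with coordinates $(x^\mu,y^a,p_a^\mu)$ and the polysymplectic structure $$\Omega=[d\Theta \bmod \textstyle\bigwedge^{n+1}_1(Z)]=[-dy^a\wedge dp_a^\mu\wedge\omega_\mu],\qquad \Theta=[p_a^\mu\,dy^a\wedge\omega_\mu \bmod \textstyle\bigwedge^n_0(Z)],\qquad \omega_\mu=\partial_\mu\lrcorner\,\omega .$$ On horizontal forms (forms on $Z$ that are semi-basic over $X$) put $F\bullet G=*^{-1}(*F\wedge *G)$. A smooth horizontal $(n-1)$-form $F$ is *Hamiltonian* if there is a vertical vector field $X_F$ on $Z$ with $X_F\lrcorner\,\Omega=dF$, an equality modulo $\bigwedge^n_0(Z)$. The Poisson–Gerstenhaber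 bracket of Hamiltonian $(n-1)$-forms is $\{F,G\}=-X_F\lrcorner\, dG$, again a horizontal $(n-1)$-form. Let $(\mathfrak C_m)$ be a finite family of Hamiltonian $(n-1)$-forms, the constraints. The constraint surface is the set of points of $Z$ at which all $\mathfrak C_m$ vanish, and $A\approx B$ means that $A=B$ at every point of the constraint surface. A constraint $\mathfrak C_k$ is *second class* if $\{\mathfrak C_k,\mathfrak C_m\}\not\approx0$ for at least one $m$. Suppose that the matrix $\mathfrak C_{mn}=\{\mathfrak C_m,\mathfrak C_n\}$ of the second-class constraints is invertible in the following sense: there are horizontal one-forms $\mathfrak C^{-1}_{mn}$ with $$\sum_n \mathfrak C^{-1}_{mn}\wedge\mathfrak C_{nk}\approx\delta_{mk}\,\omega ,$$ and fix any such one-forms. For Hamiltonian $(n-1)$-forms $F,G$ define the Dirac bracket $$\{F,G\}^D=\{F,G\}-\sigma\sum_{m,n}\{F,\mathfrak C_m\}\bullet\bigl(\mathfrak C^{-1}_{mn}\wedge\{\mathfrak C_n,G\}\bigr),$$ where $m,n$ run over the second-class constraints. **Proposition.** For every Hamiltonian $(n-1)$-form $F$ and every second-class constraint $\mathfrak C_k$,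 one has $\{F,\mathfrak C_k\}^D\approx 0$. -/

import Mathlib

open scoped Manifold ContDiff Topology BigOperators
open Bundle

noncomputable section

namespace DeDonderWeyl

/-! ### Exterior algebra of a tangent space -/

theorem append_update_right {T : Type*} {p q : ℕ} (u : Fin p → T) (v : Fin q → T)
    [DecidableEq (Fin q)] (j : Fin q) (x : T) :
    Fin.append u (Function.update v j x) =
      Function.update (Fin.append u v) (Fin.natAdd p j) x := by
  funext i
  refine Fin.addCases (fun a => ?_) (fun b => ?_) i
  · have : Fin.castAdd q a ≠ Fin.natAdd p j := by
      intro hh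
      have := congrArg Fin.val hh
      simp at this
      omega
    simp [this]
  · by_cases hb : b = j
    · subst hb; simp
    · have : Fin.natAdd p b ≠ Fin.natAdd p j := by
        intro hh
        exact hb (by simpa [Fin.ext_iff] using hh)
      simp [this, hb]

section Pointwise

variable {T : Type*} [AddCommGroup T] [Module ℝ T] [TopologicalSpace T]

/-- The `k`-forms on `T` that vanish as soon as `q + 1` of their arguments lie in `W`. -/
def horizontalForms (W : Submodule ℝ T) (k q : ℕ) : Submodule ℝ (T [⋀^Fin k]→L[ℝ] ℝ) where
  carrier := {α | ∀ (v : Fin k → T) (s : Finset (Fin k)), s.card = q + 1 →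
    (∀ i ∈ s, v i ∈ W) → α v = 0}
  add_mem' ha hb v s hs hv := by simp [ha v s hs hv, hb v s hs hv]
  zero_mem' _ _ _ _ := rfl
  smul_mem' c α ha v s hs hv := by simp [ha v s hs hv]

/-- Interior product `v ⌟ α = α(v, ·, …, ·)`. -/
def interiorProd {k : ℕ} (v : T) (α : T [⋀^Fin (k + 1)]→L[ℝ] ℝ) : T [⋀^Fin k]→L[ℝ] ℝ :=
  { α.toAlternatingMap.curryLeft v with
    cont := α.cont.comp (by
      refine continuous_pi fun i => ?_
      refine Fin.cases ?_ (fun j => ?_) i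
      · simpa using continuous_const
      · simpa using continuous_apply j) }

/-- Product of the values of two forms on the first `p` and on the last `q` arguments. -/
def tensorForm {p q : ℕ} (α : T [⋀^Fin p]→L[ℝ] ℝ) (β : T [⋀^Fin q]→L[ℝ] ℝ) :
    ContinuousMultilinearMap ℝ (fun _ : Fin (p + q) => T) ℝ where
  toMultilinearMap :=
    ((LinearMap.mul' ℝ ℝ).compMultilinearMap
      (α.toMultilinearMap.domCoprod β.toMultilinearMap)).domDomCongr finSumFinEquiv
  cont := by
    have h : Continuous fun v : Fin (p + q) → T =>
        α (fun i => v (Fin.castAdd q i)) * β (fun j => v (Fin.natAdd p j)) := by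
      refine (α.cont.comp (by fun_prop)).mul (β.cont.comp (by fun_prop))
    exact h

/-- Exterior product, regarded as a form of degree `r = p + q`, in the normalization
`(α ∧ β)(v) = (1 / (p! q!)) ∑_s sign(s) α(v_{s 1}, …, v_{s p}) β(v_{s (p+1)}, …, v_{s (p+q)})`. -/
def wedge {p q r : ℕ} (h : p + q = r) (α : T [⋀^Fin p]→L[ℝ] ℝ) (β : T [⋀^Fin q]→L[ℝ] ℝ) :
    T [⋀^Fin r]→L[ℝ] ℝ :=
  { (((p.factorial * q.factorial : ℕ) : ℝ)⁻¹ •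
      ContinuousMultilinearMap.alternatization (tensorForm α β)).toAlternatingMap.domDomCongr
        (finCongr h) with
    cont := (((p.factorial * q.factorial : ℕ) : ℝ)⁻¹ •
      ContinuousMultilinearMap.alternatization (tensorForm α β)).cont.comp
        (continuous_pi fun i => continuous_apply (finCongr h i)) }

/-- Insertion of `p` vectors into the first `p` slots of an `n`-form, where `n = p + q`. -/
def insertFirst {n p q : ℕ} (h : p + q = n) (η : T [⋀^Fin n]→L[ℝ] ℝ) (u : Fin p → T) :
    T [⋀^Fin q]→L[ℝ] ℝ where
  toFun v := η fun i => Fin.append u v (Fin.cast h.symm i)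
  map_update_add' v j x y := by
    subst h
    simp [append_update_right]
  map_update_smul' v j c x := by
    subst h
    simp [append_update_right]
  map_eq_zero_of_eq' v i j hv hij := by
    subst h
    refine η.map_eq_zero_of_eq _ (i := Fin.natAdd p i) (j := Fin.natAdd p j) ?_ ?_
    · simpa using hv
    · simpa [Fin.ext_iff] using hij
  cont := by
    subst h
    refine η.cont.comp (continuous_pi fun i => ?_)
    refine Fin.addCases (fun a => ?_) (fun b => ?_) i
    · simpa using continuous_const
    · simpa using continuous_apply b

/-- Gram matrix of a bilinear form in a basis. -/
def gram {n : ℕ} (g : T →L[ℝ] T →L[ℝ] ℝ) (b : Module.Basis (Fin n) ℝ T) :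
    Matrix (Fin n) (Fin n) ℝ :=
  Matrix.of fun i j => g (b i) (b j)

/-- Hodge star from `p`-forms to `q`-forms, `p + q = n`, of a metric `g` with volume form `η`:
`(*α)_{ν_1 … ν_q} = (1 / p!) α_{κ_1 … κ_p} g^{κ_1 μ_1} … g^{κ_p μ_p} η_{μ_1 … μ_p ν_1 … ν_q}`,
where `g^{κ μ}` is the inverse of the Gram matrix in the basis `b` (the result does not depend
on `b`).  In this convention `*1 = η`. -/
def hodge {n p q : ℕ} (g : T →L[ℝ] T →L[ℝ] ℝ) (η : T [⋀^Fin n]→L[ℝ] ℝ)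
    (b : Module.Basis (Fin n) ℝ T) (h : p + q = n) (α : T [⋀^Fin p]→L[ℝ] ℝ) :
    T [⋀^Fin q]→L[ℝ] ℝ :=
  ((p.factorial : ℕ) : ℝ)⁻¹ • ∑ K : Fin p → Fin n, ∑ M : Fin p → Fin n,
    (α (fun i => b (K i)) * ∏ i, (gram g b)⁻¹ (K i) (M i)) •
      insertFirst h η (fun i => b (M i))

/-- Co-exterior product `α • β = *⁻¹(*α ∧ *β)` of a `p`-form and a `q`-form; here
`p' = n - p`, `q' = n - q` and `r = p + q - n` is the degree of the product. -/
def coext {n p p' q q' r : ℕ} (g : T →L[ℝ] T →L[ℝ] ℝ) (η : T [⋀^Fin n]→L[ℝ] ℝ)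
    (b : Module.Basis (Fin n) ℝ T) (hp : p + p' = n) (hq : q + q' = n) (hr : r + (p' + q') = n)
    (α : T [⋀^Fin p]→L[ℝ] ℝ) (β : T [⋀^Fin q]→L[ℝ] ℝ) : T [⋀^Fin r]→L[ℝ] ℝ :=
  Function.invFun (hodge g η b hr) (wedge rfl (hodge g η b hp α) (hodge g η b hq β))

end Pointwise

/-! ### Differential forms on manifolds -/

section Forms

variable {E H : Type*} [NormedAddCommGroup E] [NormedSpace ℝ E] [TopologicalSpace H]
  (I : ModelWithCorners ℝ E H) {M : Type*} [TopologicalSpace M] [ChartedSpace H M]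

/-- A (not necessarily smooth) differential `k`-form on `M`. -/
def Form (M : Type*) [TopologicalSpace M] [ChartedSpace H M] (k : ℕ) :=
  ∀ z : M, TangentSpace I z [⋀^Fin k]→L[ℝ] ℝ

/-- Derivative at `z` of the preferred chart around `z₀`. -/
def chartDeriv (z₀ z : M) : TangentSpace I z →L[ℝ] E :=
  (NormedSpace.fromTangentSpace (𝕜 := ℝ) (extChartAt I z₀ z)).toContinuousLinearMap ∘L
    mfderiv I 𝓘(ℝ, E) (extChartAt I z₀) z

/-- Derivative at `u` of the inverse of the preferred chart around `z₀`. -/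
def chartSymmDeriv (z₀ : M) (u : E) : E →L[ℝ] TangentSpace I ((extChartAt I z₀).symm u) :=
  mfderiv 𝓘(ℝ, E) I (extChartAt I z₀).symm u ∘L
    (NormedSpace.fromTangentSpace (𝕜 := ℝ) u).symm.toContinuousLinearMap

variable {I}

/-- Coordinate expression of a form in the preferred chart around `z₀`. -/
def Form.inChart {k : ℕ} (φ : Form I M k) (z₀ : M) (u : E) : E [⋀^Fin k]→L[ℝ] ℝ :=
  (φ ((extChartAt I z₀).symm u)).compContinuousLinearMap (chartSymmDeriv I z₀ u)

/-- Exterior derivative, computed in the preferred chart (for manifolds without boundary). -/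
def Form.d {k : ℕ} (φ : Form I M k) : Form I M (k + 1) := fun z =>
  (extDeriv (φ.inChart z) (extChartAt I z z)).compContinuousLinearMap (chartDeriv I z z)

/-- `φ` is smooth near `z`. -/
def Form.SmoothAt {k : ℕ} (φ : Form I M k) (z : M) : Prop :=
  ContDiffAt ℝ ∞ (φ.inChart z) (extChartAt I z z)

end Forms

/-! ### Space-time -/

/-- Model of the `n`-dimensional space-time, `n = d + 1`. -/
abbrev Base (d : ℕ) := EuclideanSpace ℝ (Fin (d + 1))

/-- Model of the `m`-dimensional fibres of the configuration bundle. -/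
abbrev Fib (m : ℕ) := EuclideanSpace ℝ (Fin m)

/-- A pseudo-Riemannian metric (of arbitrary signature) with its volume form on a
`(d + 1)`-dimensional manifold; the volume form fixes the orientation. -/
structure SpaceTime (d : ℕ) (X : Type*) [TopologicalSpace X] [ChartedSpace (Base d) X]
    [IsManifold 𝓘(ℝ, Base d) ∞ X] where
  metric : ∀ x : X, TangentSpace 𝓘(ℝ, Base d) x →L[ℝ] TangentSpace 𝓘(ℝ, Base d) x →L[ℝ] ℝ
  symm : ∀ x v w, metric x v w = metric x w v
  nondegenerate : ∀ x v, (∀ w, metric x v w = 0) → v = 0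
  contMDiff : ContMDiff 𝓘(ℝ, Base d) (𝓘(ℝ, Base d).prod 𝓘(ℝ, Base d →L[ℝ] Base d →L[ℝ] ℝ)) ∞
    (fun x => TotalSpace.mk' (Base d →L[ℝ] Base d →L[ℝ] ℝ)
      (E := fun x : X => TangentSpace 𝓘(ℝ, Base d) x →L[ℝ] TangentSpace 𝓘(ℝ, Base d) x →L[ℝ] ℝ)
      x (metric x))
  vol : Form 𝓘(ℝ, Base d) X (d + 1)
  vol_smooth : ∀ x, vol.SmoothAt x
  vol_sq : ∀ (x : X) (b : Module.Basis (Fin (d + 1)) ℝ (TangentSpace 𝓘(ℝ, Base d) x)),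
    vol x b ^ 2 = |(gram (metric x) b).det|

section Basis

variable {d : ℕ} {X : Type*} [TopologicalSpace X] [ChartedSpace (Base d) X]

/-- The coordinate basis of a tangent space. -/
def tangentBasis (x : X) : Module.Basis (Fin (d + 1)) ℝ (TangentSpace 𝓘(ℝ, Base d) x) :=
  (EuclideanSpace.basisFun (Fin (d + 1)) ℝ).toBasis

/-- The signature `σ = ± 1` of the metric: the sign of its determinant, so that `*vol = σ`. -/
def SpaceTime.sgn [IsManifold 𝓘(ℝ, Base d) ∞ X] (S : SpaceTime d X) (x : X) : ℝ :=
  SignType.sign (gram (S.metric x) (tangentBasis x)).det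

end Basis

/-! ### The configuration bundle -/

/-- A fibred manifold `Y → X`, given with an atlas of adapted charts: every chart `(x^μ, y^a)` of
the atlas of `Y` covers a chart `(x^μ)` of `X`. -/
structure FibredManifold (d m : ℕ) (X Y : Type*) [TopologicalSpace X] [ChartedSpace (Base d) X]
    [TopologicalSpace Y] [ChartedSpace (Base d × Fib m) Y] where
  proj : Y → X
  surjective : Function.Surjective proj
  adapted : ∀ e ∈ atlas (Base d × Fib m) Y,
    ∃ c ∈ IsManifold.maximalAtlas 𝓘(ℝ, Base d) ∞ X,
      ∀ y ∈ e.source, proj y ∈ c.source ∧ c (proj y) = (e y).1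

/-- The vertical subspace `{0} × Fib` of the model of `Y`. -/
abbrev modelVertical (d m : ℕ) : Submodule ℝ (Base d × Fib m) :=
  LinearMap.ker (LinearMap.fst ℝ (Base d) (Fib m))

/-! ### The extended polymomentum phase space `⋀ⁿ_1(Y) / ⋀ⁿ_0(Y) → Y` -/

/-- Model of the fibre of `⋀ⁿ_1(Y)`: the `n`-forms annihilated by two vertical vectors. -/
abbrev Forms1 (d m : ℕ) : Submodule ℝ ((Base d × Fib m) [⋀^Fin (d + 1)]→L[ℝ] ℝ) :=
  horizontalForms (modelVertical d m) (d + 1) 1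

instance (d m : ℕ) : NormedAddCommGroup (Forms1 d m) := Submodule.normedAddCommGroup _

instance (d m : ℕ) : NormedSpace ℝ (Forms1 d m) := Submodule.normedSpace _

/-- Model of the fibre of `⋀ⁿ_0(Y)` inside `⋀ⁿ_1(Y)`. -/
abbrev Forms0 (d m : ℕ) : Submodule ℝ (Forms1 d m) :=
  (horizontalForms (modelVertical d m) (d + 1) 0).submoduleOf (Forms1 d m)

theorem finiteDimensional_forms {E : Type*} [NormedAddCommGroup E] [NormedSpace ℝ E]
    [FiniteDimensional ℝ E] (k : ℕ) : FiniteDimensional ℝ (E [⋀^Fin k]→L[ℝ] ℝ) := by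
  let f : (E [⋀^Fin k]→L[ℝ] ℝ) →ₗ[ℝ] MultilinearMap ℝ (fun _ : Fin k => E) ℝ :=
    { toFun := fun α => α.toMultilinearMap, map_add' := fun _ _ => rfl, map_smul' := fun _ _ => rfl }
  refine FiniteDimensional.of_injective f ?_
  intro a b hab
  ext v
  exact congrArg (fun h : MultilinearMap ℝ (fun _ : Fin k => E) ℝ => h v) hab

instance (d m : ℕ) : FiniteDimensional ℝ (Forms1 d m) :=
  have := finiteDimensional_forms (E := Base d × Fib m) (d + 1)
  inferInstance

instance (d m : ℕ) : IsClosed (Forms0 d m : Set (Forms1 d m)) :=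
  Submodule.closed_of_finiteDimensional _

/-- Model of the fibre of `⋀ⁿ_1(Y) / ⋀ⁿ_0(Y)`. -/
def Polymomenta (d m : ℕ) : Type := Forms1 d m ⧸ Forms0 d m

instance (d m : ℕ) : NormedAddCommGroup (Polymomenta d m) :=
  Submodule.Quotient.normedAddCommGroup (Forms0 d m)

instance (d m : ℕ) : NormedSpace ℝ (Polymomenta d m) :=
  Submodule.Quotient.normedSpace (Forms0 d m) ℝ

instance (d m : ℕ) : FiniteDimensional ℝ (Polymomenta d m) :=
  FiniteDimensional.finiteDimensional_quotient (Forms0 d m)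

/-- The class of a form. -/
def Polymomenta.mk (d m : ℕ) : Forms1 d m →ₗ[ℝ] Polymomenta d m := (Forms0 d m).mkQ

theorem Polymomenta.mk_surjective (d m : ℕ) : Function.Surjective (Polymomenta.mk d m) :=
  (Forms0 d m).mkQ_surjective

section Pullback

variable {d m : ℕ}

/-- Linear maps of the model of `Y` that map vertical vectors to vertical vectors. -/
def PreservesVertical (L : Base d × Fib m →L[ℝ] Base d × Fib m) : Prop :=
  ∀ v, v.1 = 0 → (L v).1 = 0

theorem comp_mem_horizontalForms {L : Base d × Fib m →L[ℝ] Base d × Fib m}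
    (hL : PreservesVertical L) (k q : ℕ) {α : (Base d × Fib m) [⋀^Fin k]→L[ℝ] ℝ}
    (hα : α ∈ horizontalForms (modelVertical d m) k q) :
    α.compContinuousLinearMap L ∈ horizontalForms (modelVertical d m) k q :=
  fun v s hs hv => hα (fun i => L (v i)) s hs fun i hi => hL _ (hv i hi)

/-- Pull-back of classes of forms along a linear map that preserves vertical vectors. -/
def pullPolyLinear {L : Base d × Fib m →L[ℝ] Base d × Fib m} (hL : PreservesVertical L) :
    Polymomenta d m →ₗ[ℝ] Polymomenta d m :=
  (Forms0 d m).mapQ (Forms0 d m)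
    ((ContinuousAlternatingMap.compContinuousLinearMapₗ L).restrict
      (fun _ hα => comp_mem_horizontalForms hL _ _ hα))
    (fun _ hα => comp_mem_horizontalForms hL _ _ hα)

open Classical in
/-- Pull-back of classes of forms (zero if vertical vectors are not preserved). -/
def pullPoly (L : Base d × Fib m →L[ℝ] Base d × Fib m) : Polymomenta d m →L[ℝ] Polymomenta d m :=
  if hL : PreservesVertical L then LinearMap.toContinuousLinearMap (pullPolyLinear hL) else 0

theorem pullPoly_mk {L : Base d × Fib m →L[ℝ] Base d × Fib m} (hL : PreservesVertical L)
    (α : Forms1 d m) :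
    pullPoly L (Polymomenta.mk d m α) = Polymomenta.mk d m
      ⟨α.1.compContinuousLinearMap L, comp_mem_horizontalForms hL _ _ α.2⟩ := by
  rw [pullPoly, dif_pos hL]
  rfl

theorem contDiff_comp {E : Type*} [NormedAddCommGroup E] [NormedSpace ℝ E]
    [FiniteDimensional ℝ E] {k : ℕ} (α : E [⋀^Fin k]→L[ℝ] ℝ) :
    ContDiff ℝ ∞ fun L : E →L[ℝ] E => α.compContinuousLinearMap L := by
  have : FiniteDimensional ℝ (ContinuousMultilinearMap ℝ (fun _ : Fin k => E) ℝ) := by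
    let f : ContinuousMultilinearMap ℝ (fun _ : Fin k => E) ℝ →ₗ[ℝ]
        MultilinearMap ℝ (fun _ : Fin k => E) ℝ :=
      { toFun := fun α => α.toMultilinearMap
        map_add' := fun _ _ => rfl
        map_smul' := fun _ _ => rfl }
    exact FiniteDimensional.of_injective f ContinuousMultilinearMap.toMultilinearMap_injective
  let j : (E [⋀^Fin k]→L[ℝ] ℝ) →L[ℝ] ContinuousMultilinearMap ℝ (fun _ : Fin k => E) ℝ :=
    ContinuousAlternatingMap.toContinuousMultilinearMapCLM ℝ
  have hj : Function.Injective j := ContinuousAlternatingMap.toContinuousMultilinearMap_injective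
  have h1 : ContDiff ℝ ∞ fun L : E →L[ℝ] E => j (α.compContinuousLinearMap L) :=
    (ContinuousMultilinearMap.contDiff
      (ContinuousMultilinearMap.compContinuousLinearMapLRight
        (E := fun _ : Fin k => E) (j α))).comp (contDiff_pi.2 fun _ => contDiff_id)
  obtain ⟨r, hr⟩ := j.toLinearMap.exists_leftInverse_of_injective
    (LinearMap.ker_eq_bot_of_injective hj)
  have h2 := (LinearMap.toContinuousLinearMap r).contDiff.comp h1
  convert h2 using 1
  funext L
  exact (LinearMap.congr_fun hr (α.compContinuousLinearMap L)).symm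

/-- On the maps that preserve vertical vectors, the pull-back depends smoothly on the map. -/
theorem exists_contDiff_pullPoly :
    ∃ Φ : (Base d × Fib m →L[ℝ] Base d × Fib m) → (Polymomenta d m →L[ℝ] Polymomenta d m),
      ContDiff ℝ ∞ Φ ∧ ∀ L, PreservesVertical L → Φ L = pullPoly L := by
  have := finiteDimensional_forms (E := Base d × Fib m) (d + 1)
  obtain ⟨s, hs⟩ := (Polymomenta.mk d m).exists_rightInverse_of_surjective
    (LinearMap.range_eq_top.2 (Polymomenta.mk_surjective d m))
  obtain ⟨r, hr⟩ := (Forms1 d m).subtype.exists_leftInverse_of_injective (Submodule.ker_subtype _)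
  let Φ : (Base d × Fib m →L[ℝ] Base d × Fib m) → (Polymomenta d m →L[ℝ] Polymomenta d m) :=
    fun L => LinearMap.toContinuousLinearMap (Polymomenta.mk d m ∘ₗ r ∘ₗ
      ContinuousAlternatingMap.compContinuousLinearMapₗ L ∘ₗ (Forms1 d m).subtype ∘ₗ s)
  refine ⟨Φ, contDiff_clm_apply_iff.2 fun p => ?_, fun L hL => ?_⟩
  · exact (LinearMap.toContinuousLinearMap (Polymomenta.mk d m ∘ₗ r)).contDiff.comp
      (contDiff_comp (s p).1)
  · ext p
    have hp : Polymomenta.mk d m (s p) = p := LinearMap.congr_fun hs p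
    have h1 : pullPoly L p = Polymomenta.mk d m
        ⟨(s p).1.compContinuousLinearMap L, comp_mem_horizontalForms hL _ _ (s p).2⟩ := by
      rw [← pullPoly_mk hL, hp]
    rw [h1]
    exact congrArg (Polymomenta.mk d m) (LinearMap.congr_fun hr
      ⟨(s p).1.compContinuousLinearMap L, comp_mem_horizontalForms hL _ _ (s p).2⟩)

end Pullback

section Core

variable {d m : ℕ} {X Y : Type*} [TopologicalSpace X] [ChartedSpace (Base d) X]
    [TopologicalSpace Y] [ChartedSpace (Base d × Fib m) Y] [IsManifold 𝓘(ℝ, Base d × Fib m) ∞ Y]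

/-- The coordinate changes of `Y` map vertical vectors to vertical vectors. -/
theorem FibredManifold.preservesVertical
    (P : FibredManifold d m X Y) (i j : atlas (Base d × Fib m) Y) (y : Y)
    (hi : y ∈ i.1.source) (hj : y ∈ j.1.source) :
    PreservesVertical ((tangentBundleCore 𝓘(ℝ, Base d × Fib m) Y).coordChange i j y) := by
  intro v hv
  obtain ⟨ci, -, hci⟩ := P.adapted i.1 i.2
  obtain ⟨cj, -, hcj⟩ := P.adapted j.1 j.2
  set f : Base d × Fib m → Base d × Fib m := j.1 ∘ i.1.symm with hf
  set u := i.1 y with hu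
  have hc : (tangentBundleCore 𝓘(ℝ, Base d × Fib m) Y).coordChange i j y = fderiv ℝ f u := by
    simp [tangentBundleCore_coordChange, hf, hu]
  have hd : DifferentiableAt ℝ f u := by
    have := (𝓘(ℝ, Base d × Fib m)).contDiffWithinAt_extendCoordChange' (n := ∞)
      (IsManifold.subset_maximalAtlas i.2) (IsManifold.subset_maximalAtlas j.2) hi hj
    rw [show Set.range 𝓘(ℝ, Base d × Fib m) = Set.univ by simp, contDiffWithinAt_univ] at this
    exact this.differentiableAt (by simp)
  rw [hc]
  have h1 : HasDerivAt (fun t : ℝ => (f (u + t • v)).1) (fderiv ℝ f u v).1 0 := by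
    have h0 : HasDerivAt (fun t : ℝ => u + t • v) v 0 := by
      simpa using ((hasDerivAt_id (0 : ℝ)).smul_const v).const_add u
    have hd' : HasFDerivAt f (fderiv ℝ f u) (u + (0 : ℝ) • v) := by simpa using hd.hasFDerivAt
    exact ((ContinuousLinearMap.fst ℝ (Base d) (Fib m)).hasFDerivAt).comp_hasDerivAt 0
      (hd'.comp_hasDerivAt 0 h0)
  have h2 : (fun t : ℝ => (f (u + t • v)).1) =ᶠ[𝓝 0] fun _ => cj (ci.symm u.1) := by
    have hcont : Filter.Tendsto (fun t : ℝ => u + t • v) (𝓝 0) (𝓝 u) := by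
      have : Continuous fun t : ℝ => u + t • v := by fun_prop
      simpa using this.tendsto 0
    have hN : (i.1.symm.trans j.1).source ∈ 𝓝 u :=
      (i.1.symm.trans j.1).open_source.mem_nhds (by simp [hu, hi, hj])
    filter_upwards [hcont hN] with t ht
    simp only [Set.mem_preimage, OpenPartialHomeomorph.trans_source,
      OpenPartialHomeomorph.symm_source, Set.mem_inter_iff] at ht
    obtain ⟨ht1, ht2⟩ := ht
    have a1 := hci _ (i.1.map_target ht1)
    have a2 := hcj _ ht2
    rw [i.1.right_inv ht1] at a1
    have a3 : (u + t • v).1 = u.1 := by simp [hv]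
    rw [a3] at a1
    show (j.1 (i.1.symm (u + t • v))).1 = _
    rw [← a2.2, ← a1.2, ci.left_inv a1.1]
  exact h1.unique ((hasDerivAt_const (0 : ℝ) _).congr_of_eventuallyEq h2)

theorem FibredManifold.contMDiffOn_pullPoly (P : FibredManifold d m X Y)
    (i j : atlas (Base d × Fib m) Y) :
    ContMDiffOn 𝓘(ℝ, Base d × Fib m) 𝓘(ℝ, Polymomenta d m →L[ℝ] Polymomenta d m) ∞
      (fun y => pullPoly ((tangentBundleCore 𝓘(ℝ, Base d × Fib m) Y).coordChange j i y))
      (i.1.source ∩ j.1.source) := by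
  obtain ⟨Φ, hΦ, h⟩ := exists_contDiff_pullPoly (d := d) (m := m)
  have : IsManifold 𝓘(ℝ, Base d × Fib m) (∞ + 1) Y := ‹IsManifold 𝓘(ℝ, Base d × Fib m) ∞ Y›
  have hT := (tangentBundleCore.isContMDiff (I := 𝓘(ℝ, Base d × Fib m)) (M := Y)
    (n := ∞)).contMDiffOn_coordChange j i
  refine (hΦ.contMDiff.comp_contMDiffOn (hT.mono fun y hy => ⟨hy.2, hy.1⟩)).congr fun y hy => ?_
  exact (h _ (P.preservesVertical j i y hy.2 hy.1)).symm

/-- The bundle of classes of `n`-forms `⋀ⁿ_1(Y) / ⋀ⁿ_0(Y)` over `Y`: in the chart `i` a class is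
represented by the class of a form on the model space, and the transition functions are the
pull-backs by the derivatives of the coordinate changes of `Y`. -/
def FibredManifold.core (P : FibredManifold d m X Y) :
    VectorBundleCore ℝ Y (Polymomenta d m) (atlas (Base d × Fib m) Y) where
  baseSet i := i.1.source
  isOpen_baseSet i := i.1.open_source
  indexAt := achart (Base d × Fib m)
  mem_baseSet_at := mem_chart_source (Base d × Fib m)
  coordChange i j y := pullPoly ((tangentBundleCore 𝓘(ℝ, Base d × Fib m) Y).coordChange j i y)
  coordChange_self i y hy v := by
    obtain ⟨α, rfl⟩ := Polymomenta.mk_surjective d m v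
    rw [pullPoly_mk (P.preservesVertical i i y hy hy)]
    congr 1
    ext w
    exact congrArg α.1 (funext fun a =>
      (tangentBundleCore 𝓘(ℝ, Base d × Fib m) Y).coordChange_self i y hy (w a))
  continuousOn_coordChange i j := (P.contMDiffOn_pullPoly i j).continuousOn
  coordChange_comp i j k y hy v := by
    obtain ⟨⟨hi, hj⟩, hk⟩ := hy
    obtain ⟨α, rfl⟩ := Polymomenta.mk_surjective d m v
    rw [pullPoly_mk (P.preservesVertical j i y hj hi), pullPoly_mk (P.preservesVertical k j y hk hj),
      pullPoly_mk (P.preservesVertical k i y hk hi)]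
    congr 1
    ext w
    exact congrArg α.1 (funext fun a =>
      (tangentBundleCore 𝓘(ℝ, Base d × Fib m) Y).coordChange_comp k j i y ⟨⟨hk, hj⟩, hi⟩ (w a))

instance (P : FibredManifold d m X Y) : P.core.IsContMDiff 𝓘(ℝ, Base d × Fib m) ∞ :=
  ⟨fun i j => P.contMDiffOn_pullPoly i j⟩

/-- The extended polymomentum phase space `Z = ⋀ⁿ_1(Y) / ⋀ⁿ_0(Y)`: its points are pairs of a
point `y` of `Y` and a class `z.2` of `n`-forms on the tangent space of `Y` at `y` (which is
identified with the model space by the preferred chart at `y`). -/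
abbrev FibredManifold.Z (P : FibredManifold d m X Y) := TotalSpace (Polymomenta d m) P.core.Fiber

/-- The model with corners of `Z`. -/
abbrev modelZ (d m : ℕ) := 𝓘(ℝ, Base d × Fib m).prod 𝓘(ℝ, Polymomenta d m)

theorem FibredManifold.isManifold_Z (P : FibredManifold d m X Y) :
    IsManifold (modelZ d m) ∞ P.Z := inferInstance

/-- The projection `Z → X`. -/
def FibredManifold.toBase (P : FibredManifold d m X Y) (z : P.Z) : X := P.proj z.proj

/-- The derivative of the projection `Z → X`. -/
def FibredManifold.baseDeriv (P : FibredManifold d m X Y) (z : P.Z) :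
    TangentSpace (modelZ d m) z →L[ℝ] TangentSpace 𝓘(ℝ, Base d) (P.toBase z) :=
  mfderiv (modelZ d m) 𝓘(ℝ, Base d) P.toBase z

/-- The vertical tangent vectors of `Z`. -/
def FibredManifold.vertical (P : FibredManifold d m X Y) (z : P.Z) :
    Submodule ℝ (TangentSpace (modelZ d m) z) :=
  LinearMap.ker (P.baseDeriv z).toLinearMap

/-! ### The polysymplectic structure -/

/-- The value at `z` of the `n`-form `θ` on `Z` belongs to the canonical class
`Θ = [p_a^μ dy^a ∧ ω_μ mod ⋀ⁿ_0]`: it is, modulo horizontal `n`-forms, the pull-back along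
`Z → Y` of a form in the class `z`. -/
def FibredManifold.RepresentsTheta (P : FibredManifold d m X Y)
    (θ : Form (modelZ d m) P.Z (d + 1)) (z : P.Z) : Prop :=
  ∃ α : Forms1 d m, Polymomenta.mk d m α = z.2 ∧
    θ z - α.1.compContinuousLinearMap (chartDeriv 𝓘(ℝ, Base d × Fib m) z.proj z.proj ∘L
      mfderiv (modelZ d m) 𝓘(ℝ, Base d × Fib m) (fun w : P.Z => w.proj) z) ∈
        horizontalForms (P.vertical z) (d + 1) 0

/-- The polysymplectic structure `Ω = [dΘ mod ⋀ⁿ⁺¹_1(Z)]` at `z`, as a set of `(n + 1)`-forms. -/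
def FibredManifold.polysymplectic (P : FibredManifold d m X Y) (z : P.Z) :
    Set (TangentSpace (modelZ d m) z [⋀^Fin (d + 2)]→L[ℝ] ℝ) :=
  {Ω | ∃ θ : Form (modelZ d m) P.Z (d + 1), (∀ᶠ w in 𝓝 z, P.RepresentsTheta θ w) ∧
    θ.SmoothAt z ∧ Ω - θ.d z ∈ horizontalForms (P.vertical z) (d + 2) 1}

/-! ### Hamiltonian forms and the Poisson-Gerstenhaber bracket -/

/-- Horizontal (semi-basic) `k`-forms on `Z`: the value at `z` is a form on the tangent space of
`X` at the base point of `z`. -/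
def HForm (P : FibredManifold d m X Y) (k : ℕ) :=
  ∀ z : P.Z, TangentSpace 𝓘(ℝ, Base d) (P.toBase z) [⋀^Fin k]→L[ℝ] ℝ

variable {P : FibredManifold d m X Y}

/-- A horizontal form as a differential form on `Z`. -/
def HForm.toForm {k : ℕ} (F : HForm P k) : Form (modelZ d m) P.Z k := fun z =>
  (F z).compContinuousLinearMap (P.baseDeriv z)

/-- The vertical vector `v` at `z` solves `v ⌟ Ω = dF`.  As `Ω` is a class modulo `⋀ⁿ⁺¹_1(Z)`, this
is an equality modulo `⋀ⁿ_0(Z)`. -/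
def IsHamiltonianVector (F : HForm P d) (z : P.Z) (v : TangentSpace (modelZ d m) z) : Prop :=
  v ∈ P.vertical z ∧ ∃ Ω ∈ P.polysymplectic z,
    interiorProd v Ω - F.toForm.d z ∈ horizontalForms (P.vertical z) (d + 1) 0

/-- Hamiltonian `(n - 1)`-forms: the smooth horizontal forms that have a Hamiltonian vector field
(which is unique, and hence smooth). -/
def IsHamiltonian (F : HForm P d) : Prop :=
  (∀ z, F.toForm.SmoothAt z) ∧ ∀ z, ∃ v, IsHamiltonianVector F z v

/-- `β` is the value at `z` of the bracket of `F` and `G`, i.e. `β = - X_F ⌟ dG` (the general sign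
`(-1)^(n - p)` is `-1` for `p = n - 1`). -/
def IsPGBracketAt (F G : HForm P d) (z : P.Z)
    (β : TangentSpace 𝓘(ℝ, Base d) (P.toBase z) [⋀^Fin d]→L[ℝ] ℝ) : Prop :=
  ∃ v, IsHamiltonianVector F z v ∧
    β.compContinuousLinearMap (P.baseDeriv z) = - interiorProd v (G.toForm.d z)

open Classical in
/-- The Poisson-Gerstenhaber bracket of a Hamiltonian `(n - 1)`-form `F` with a smooth horizontal
`(n - 1)`-form `G` (zero by convention where `F` has no Hamiltonian vector). -/
def pgBracket (F G : HForm P d) : HForm P d := fun z =>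
  if h : ∃ β, IsPGBracketAt F G z β then h.choose else 0

/-! ### Constraints and the Dirac bracket -/

variable {ι : Type*}

/-- The constraint surface. -/
def constraintSurface (C : ι → HForm P d) : Set P.Z := {z | ∀ i, C i z = 0}

/-- `F ≈ 0`: the form `F` vanishes on the constraint surface. -/
def WeaklyZero {k : ℕ} (C : ι → HForm P d) (F : HForm P k) : Prop :=
  ∀ z ∈ constraintSurface C, F z = 0

/-- `F` is second class: its bracket with at least one constraint does not vanish weakly. -/
def IsSecondClass (C : ι → HForm P d) (F : HForm P d) : Prop :=
  ∃ i, ¬ WeaklyZero C (pgBracket F (C i))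

open Classical in
/-- The indices of the second-class constraints. -/
def secondClass [Fintype ι] (C : ι → HForm P d) : Finset ι :=
  Finset.univ.filter fun i => IsSecondClass C (C i)

variable [Fintype ι] [IsManifold 𝓘(ℝ, Base d) ∞ X]

open Classical in
/-- The matrix `D` of horizontal one-forms is inverse to the matrix `{C_i, C_j}` of the second-class
constraints on the constraint surface: `∑_j D_ij ∧ {C_j, C_k} = δ_ik vol`. -/
def IsInverseMatrix (S : SpaceTime d X) (C : ι → HForm P d) (D : ι → ι → HForm P 1) : Prop :=
  ∀ z ∈ constraintSurface C, ∀ i ∈ secondClass C, ∀ k ∈ secondClass C,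
    ∑ j ∈ secondClass C, wedge (add_comm 1 d) (D i j z) (pgBracket (C j) (C k) z) =
      if i = k then S.vol (P.toBase z) else 0

/-- The Dirac bracket
`{F, G}^D = {F, G} - σ ∑_{i, j} {F, C_i} • (D_ij ∧ {C_j, G})`,
where `i` and `j` run over the second-class constraints. -/
def diracBracket (S : SpaceTime d X) (C : ι → HForm P d) (D : ι → ι → HForm P 1)
    (F G : HForm P d) : HForm P d := fun z =>
  pgBracket F G z - S.sgn (P.toBase z) •
    ∑ i ∈ secondClass C, ∑ j ∈ secondClass C,
      coext (p' := 1) (q' := 0) (S.metric (P.toBase z)) (S.vol (P.toBase z))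
        (tangentBasis (P.toBase z)) rfl rfl rfl
        (pgBracket F (C i) z) (wedge (add_comm 1 d) (D i j z) (pgBracket (C j) G z))

end Core

end DeDonderWeyl

end

/-! At a fixed point of the constraint surface the claim is linear algebra in the tangent space of
$X$, where horizontal forms take their values. Each product $D_{ij}\wedge\{C_j,C_k\}$ has top
degree, so it is $c_{ij}\,\omega$ for a scalar $c_{ij}$, and the inverse-matrix condition says
$\sum_j c_{ij}=\delta_{ik}$. Since $*\omega=\sigma$ is a scalar,
$\alpha\bullet(c\,\omega)=*^{-1}(c\sigma\,{*\alpha})=c\sigma\,\alpha$ (`coext_smul_vol`). The double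
sum therefore collapses to $\sigma\{F,C_k\}$ (`sum_coext_eq`), and the prefactor $\sigma$ with
$\sigma^2=1$ leaves $\{F,C_k\}-\{F,C_k\}=0$. The work lies in two facts about the Hodge star: its
value on the volume form (`hodge_vol`), and its injectivity on $(n-1)$-forms (`hodge_injective`),
which lets $*^{-1}$ cancel $*$. -/

namespace DeDonderWeyl

/-! ### Sums over tuples of indices. -/

/-- A function on `p`-tuples of indices that is invariant under permutations and is supported on
the reorderings of one injective tuple `J` sums up to `p!` times its value at `J`. -/
theorem sum_eq_factorial_mul {p n : ℕ} (f : (Fin p → Fin n) → ℝ) (J : Fin p → Fin n)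
    (hJ : Function.Injective J) (hperm : ∀ s : Equiv.Perm (Fin p), f (J ∘ s) = f J)
    (hzero : ∀ K, f K ≠ 0 → ∃ s : Equiv.Perm (Fin p), J ∘ s = K) :
    ∑ K, f K = p.factorial * f J := by
  classical
  -- Injectivity of `J` makes `s ↦ J ∘ s` injective, and tuples outside its image contribute zero.
  have h : ∑ s : Equiv.Perm (Fin p), f (J ∘ s) = ∑ K, f K := by
    refine Finset.sum_of_injOn (fun s : Equiv.Perm (Fin p) => J ∘ s) ?_ (by simp) ?_ (by simp)
    · intro s _ t _ hst
      ext i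
      exact congrArg Fin.val (hJ (congrFun hst i))
    · intro K _ hK
      by_contra hne
      obtain ⟨s, hs⟩ := hzero K hne
      exact hK ⟨s, by simp, hs⟩
  rw [← h, Finset.sum_congr rfl fun s _ => hperm s]
  simp [Fintype.card_perm]

/-- Two injective tuples with the same range differ by a permutation. -/
theorem exists_perm_of_range_subset {p n : ℕ} {J K : Fin p → Fin n}
    (hK : Function.Injective K) (h : Set.range K ⊆ Set.range J) :
    ∃ s : Equiv.Perm (Fin p), J ∘ s = K := by
  -- `s i` is the position in `J` of the entry `K i`; an injective self-map of a finite set is a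
  -- permutation.
  choose s hs using fun i => h ⟨i, rfl⟩
  have hinj : Function.Injective s := fun i j hij => hK (by rw [← hs i, ← hs j, hij])
  exact ⟨Equiv.ofBijective s (Finite.injective_iff_bijective.1 hinj), funext hs⟩

/-- Both factors acquire the sign of `s`, and the two signs cancel. -/
theorem mul_perm_invariant {T : Type*} [AddCommGroup T] [Module ℝ T] {p n : ℕ}
    (α β : T [⋀^Fin p]→ₗ[ℝ] ℝ) (x y : Fin n → T)
    (J : Fin p → Fin n) (s : Equiv.Perm (Fin p)) :
    α (x ∘ (J ∘ s)) * β (y ∘ (J ∘ s)) = α (x ∘ J) * β (y ∘ J) := by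
  rw [← Function.comp_assoc, ← Function.comp_assoc, α.map_perm, β.map_perm]
  rcases Int.units_eq_one_or (Equiv.Perm.sign s) with h | h <;> simp [h]

/-- A repeated index kills an alternating form, so only injective tuples contribute to the sums
below. -/
theorem injective_of_mul_ne_zero {T : Type*} [AddCommGroup T] [Module ℝ T] {p n : ℕ}
    (α : T [⋀^Fin p]→ₗ[ℝ] ℝ) (x : Fin n → T) {c : ℝ}
    {K : Fin p → Fin n} (h : α (x ∘ K) * c ≠ 0) : Function.Injective K := by
  intro i j hij
  by_contra hne
  exact left_ne_zero_of_mul h (α.map_eq_zero_of_eq _ (by simp [hij]) hne)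

section Pointwise

variable {T : Type*} [AddCommGroup T] [Module ℝ T] [TopologicalSpace T]

/-! ### The Hodge star in the raised frame. -/

theorem insertFirst_apply {n p q : ℕ} (h : p + q = n) (η : T [⋀^Fin n]→L[ℝ] ℝ) (u : Fin p → T)
    (v : Fin q → T) :
    insertFirst h η u v = η fun i => Fin.append u v (Fin.cast h.symm i) := rfl

theorem append_update_left {T : Type*} {p q : ℕ} (u : Fin p → T) (v : Fin q → T)
    [DecidableEq (Fin p)] (j : Fin p) (x : T) :
    Fin.append (Function.update u j x) v =
      Function.update (Fin.append u v) (Fin.castAdd q j) x := by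
  funext i
  refine Fin.addCases (fun a => ?_) (fun b => ?_) i
  · by_cases ha : a = j
    · subst ha; simp
    · have : Fin.castAdd q a ≠ Fin.castAdd q j := fun hh => ha (by simpa [Fin.ext_iff] using hh)
      simp [this, ha]
  · have : Fin.natAdd p b ≠ Fin.castAdd q j := by
      intro hh
      have := congrArg Fin.val hh
      simp at this
      omega
    simp [this]

/-- The insertion of vectors is alternating in the inserted vectors. -/
def insertFirstAlternating {n p q : ℕ} (h : p + q = n) (η : T [⋀^Fin n]→L[ℝ] ℝ)
    (v : Fin q → T) : T [⋀^Fin p]→ₗ[ℝ] ℝ where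
  toFun u := insertFirst h η u v
  map_update_add' u j x y := by
    subst h
    simp [insertFirst_apply, append_update_left]
  map_update_smul' u j c x := by
    subst h
    simp [insertFirst_apply, append_update_left]
  map_eq_zero_of_eq' u i j hu hij := by
    subst h
    refine η.map_eq_zero_of_eq _ (i := Fin.castAdd q i) (j := Fin.castAdd q j) ?_ ?_
    · simpa using hu
    · simpa [Fin.ext_iff] using hij

/-- The dual frame `b^κ = g^{κ μ} b_μ` of tangent vectors. -/
noncomputable def raised {n : ℕ} (g : T →L[ℝ] T →L[ℝ] ℝ) (b : Module.Basis (Fin n) ℝ T) (κ : Fin n) : T :=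
  ∑ μ, (gram g b)⁻¹ κ μ • b μ

/-- Multilinearity in the inserted slots absorbs the inverse metrics into the raised frame. What
remains is one sum of products of two alternating functions of `K`, the shape needed for
`mul_perm_invariant` and `sum_eq_factorial_mul`. -/
theorem hodge_apply {n p q : ℕ} (g : T →L[ℝ] T →L[ℝ] ℝ) (η : T [⋀^Fin n]→L[ℝ] ℝ)
    (b : Module.Basis (Fin n) ℝ T) (h : p + q = n) (α : T [⋀^Fin p]→L[ℝ] ℝ) (v : Fin q → T) :
    hodge g η b h α v = ((p.factorial : ℕ) : ℝ)⁻¹ *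
      ∑ K : Fin p → Fin n, α (b ∘ K) * insertFirst h η (raised g b ∘ K) v := by
  have key : ∀ K : Fin p → Fin n, insertFirst h η (raised g b ∘ K) v =
      ∑ M : Fin p → Fin n, (∏ i, (gram g b)⁻¹ (K i) (M i)) *
        insertFirst h η (fun i => b (M i)) v := by
    intro K
    have h1 := (insertFirstAlternating h η v).toMultilinearMap.map_sum
      (fun i μ => (gram g b)⁻¹ (K i) μ • b μ)
    refine h1.trans (Finset.sum_congr rfl fun M _ => ?_)
    exact (insertFirstAlternating h η v).toMultilinearMap.map_smul_univ _ _
  simp only [hodge, ContinuousAlternatingMap.smul_apply, ContinuousAlternatingMap.sum_apply,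
    smul_eq_mul, key, Finset.mul_sum]
  refine Finset.sum_congr rfl fun K _ => Finset.sum_congr rfl fun M _ => ?_
  simp only [Function.comp_def]
  ring

/-- The raised frame arises from `b` by the transposed inverse Gram matrix, and a top-degree form
scales by the determinant. -/
theorem apply_raised {n : ℕ} (g : T →L[ℝ] T →L[ℝ] ℝ) (η : T [⋀^Fin n]→L[ℝ] ℝ)
    (b : Module.Basis (Fin n) ℝ T) : η (raised g b) = (gram g b).det⁻¹ * η b := by
  have h := AlternatingMap.eq_smul_basis_det b η.toAlternatingMap
  have h1 : η (raised g b) = η b * b.det (raised g b) := by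
    simpa using congrArg (fun f : T [⋀^Fin n]→ₗ[ℝ] ℝ => f (raised g b)) h
  have h2 : b.toMatrix (raised g b) = ((gram g b)⁻¹).transpose := by
    ext i j
    simp [Module.Basis.toMatrix_apply, raised, Finsupp.single_apply]
  rw [h1, Module.Basis.det_apply, h2, Matrix.det_transpose, Matrix.det_nonsing_inv,
    Ring.inverse_eq_inv', mul_comm]

/-- The Hodge star of the volume form is the sign of the determinant of the metric. -/
theorem hodge_vol {n : ℕ} (g : T →L[ℝ] T →L[ℝ] ℝ) (η : T [⋀^Fin n]→L[ℝ] ℝ)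
    (b : Module.Basis (Fin n) ℝ T) (hη : η b ^ 2 = |(gram g b).det|)
    (v : Fin 0 → T) :
    hodge g η b (add_zero n) η v = SignType.sign (gram g b).det := by
  have hins : ∀ u : Fin n → T, insertFirst (add_zero n) η u v = η u := by
    intro u
    rw [insertFirst_apply]
    congr 1
    funext i
    exact Fin.append_left u v i
  -- In top degree the reference tuple is `id`: every injective `K` is a permutation of all indices.
  have hsum := sum_eq_factorial_mul
    (fun K : Fin n → Fin n => η (b ∘ K) * η (raised g b ∘ K)) id Function.injective_id
    (fun s => mul_perm_invariant η.toAlternatingMap η.toAlternatingMap b (raised g b) id s)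
    (fun K hK => exists_perm_of_range_subset
      (injective_of_mul_ne_zero η.toAlternatingMap b hK) (by simp))
  rw [hodge_apply]
  simp only [hins]
  rw [hsum, inv_mul_cancel_left₀ (by exact_mod_cast n.factorial_ne_zero)]
  simp only [Function.comp_id, apply_raised]
  rw [mul_left_comm, ← sq, hη]
  -- The left side is now `|det| / det`; for `det = 0` both sides vanish because `0⁻¹ = 0`.
  rcases lt_trichotomy (gram g b).det 0 with h | h | h
  · rw [abs_of_neg h, sign_neg h]
    simp [h.ne]
  · simp [h]
  · rw [abs_of_pos h, sign_pos h]
    simp [h.ne']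

/-- The Hodge star is injective on forms of codegree one. -/
theorem hodge_injective {d : ℕ} (g : T →L[ℝ] T →L[ℝ] ℝ) (η : T [⋀^Fin (d + 1)]→L[ℝ] ℝ)
    (b : Module.Basis (Fin (d + 1)) ℝ T) (hη : η b ≠ 0) (hg : (gram g b).det ≠ 0)
    (h : d + 1 = d + 1) : Function.Injective (hodge (p := d) (q := 1) g η b h) := by
  intro α β hαβ
  -- An alternating form is determined by its values on injective basis tuples. Each such value is
  -- recovered from the star by evaluating it at one vector, up to a nonzero factor independent of
  -- the form.
  suffices H : ∀ J : Fin d → Fin (d + 1), Function.Injective J →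
      ∃ c ≠ 0, ∃ v, ∀ γ : T [⋀^Fin d]→L[ℝ] ℝ,
        hodge (p := d) (q := 1) g η b h γ v = γ (b ∘ J) * c by
    apply ContinuousAlternatingMap.toAlternatingMap_injective
    refine Module.Basis.ext_alternating b fun J hJ => ?_
    obtain ⟨c, hc, v, hv⟩ := H J hJ
    have := hv α
    rw [hαβ, hv β] at this
    exact (mul_right_cancel₀ hc this).symm
  intro J hJ
  -- `J` omits an index `l`; evaluating at the raised vector of `l` selects the reorderings of `J`.
  obtain ⟨l, hl⟩ : ∃ l, l ∉ Set.range J := by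
    by_contra! hs
    simpa using Fintype.card_le_of_surjective J hs
  have happ : ∀ K : Fin d → Fin (d + 1),
      insertFirst h η (raised g b ∘ K) (fun _ => raised g b l) =
        η (raised g b ∘ Fin.append K fun _ => l) := by
    intro K
    rw [insertFirst_apply]
    congr 1
    funext i
    refine Fin.addCases (fun a => ?_) (fun a => ?_) i <;> simp
  have hinj : ∀ K : Fin d → Fin (d + 1), Function.Injective K → l ∉ Set.range K →
      Function.Injective (Fin.append K fun _ : Fin 1 => l) := by
    intro K hK hlK
    rw [Fin.append_injective_iff]
    refine ⟨hK, fun i j _ => Subsingleton.elim i j, fun i j hij => hlK ⟨i, hij⟩⟩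
  refine ⟨insertFirst h η (raised g b ∘ J) fun _ => raised g b l, ?_, fun _ => raised g b l, ?_⟩
  · rw [happ]
    -- `(J, l)` lists every index once, so the factor is `± η (raised g b)`.
    let s : Equiv.Perm (Fin (d + 1)) :=
      Equiv.ofBijective _ (Finite.injective_iff_bijective.1 (hinj J hJ hl))
    have h1 : η (raised g b ∘ s) = Equiv.Perm.sign s • η (raised g b) :=
      η.toAlternatingMap.map_perm (raised g b) s
    change η (raised g b ∘ s) ≠ 0
    have h2 : η (raised g b) ≠ 0 := by
      rw [apply_raised]
      exact mul_ne_zero (inv_ne_zero hg) hη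
    rw [h1]
    rcases Int.units_eq_one_or (Equiv.Perm.sign s) with hs | hs <;> simpa [hs] using h2
  · intro γ
    rw [hodge_apply, sum_eq_factorial_mul _ J hJ
      (fun s => mul_perm_invariant γ.toAlternatingMap (insertFirstAlternating h η _) b
        (raised g b) J s), inv_mul_cancel_left₀ (by exact_mod_cast d.factorial_ne_zero)]
    intro K hK
    have hKinj := injective_of_mul_ne_zero γ.toAlternatingMap b hK
    refine exists_perm_of_range_subset hKinj ?_
    -- If `K` used `l`, the frame vector of `l` would occur twice among the arguments of `η`.
    have hlK : l ∉ Set.range K := by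
      rintro ⟨i, hi⟩
      refine right_ne_zero_of_mul hK ?_
      rw [happ]
      refine η.map_eq_zero_of_eq _ (i := Fin.castAdd 1 i) (j := Fin.natAdd d 0) ?_ ?_
      · simp [hi]
      · simp [Fin.ext_iff]
        omega
    let s : Equiv.Perm (Fin (d + 1)) :=
      Equiv.ofBijective _ (Finite.injective_iff_bijective.1 (hinj J hJ hl))
    rintro _ ⟨i, rfl⟩
    -- `J` together with `l` exhausts the indices, and `K` avoids `l`, so `K i` is an entry of `J`.
    obtain ⟨a, ha⟩ := s.surjective (K i)
    change Fin.append J (fun _ : Fin 1 => l) a = K i at ha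
    induction a using Fin.addCases with
    | left a => exact ⟨a, by simpa using ha⟩
    | right a => exact absurd ⟨i, by simpa using ha.symm⟩ hlK

theorem hodge_smul {n p q : ℕ} (g : T →L[ℝ] T →L[ℝ] ℝ) (η : T [⋀^Fin n]→L[ℝ] ℝ)
    (b : Module.Basis (Fin n) ℝ T) (h : p + q = n) (c : ℝ) (α : T [⋀^Fin p]→L[ℝ] ℝ) :
    hodge g η b h (c • α) = c • hodge g η b h α := by
  ext v
  simp only [hodge_apply, ContinuousAlternatingMap.smul_apply, smul_eq_mul, Finset.mul_sum]
  refine Finset.sum_congr rfl fun K _ => ?_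
  ring

/-! ### Co-exterior product with forms of top degree. -/

/-- The exterior product of a one-form and a scalar. -/
theorem wedge_one_zero (α : T [⋀^Fin 1]→L[ℝ] ℝ) (β : T [⋀^Fin 0]→L[ℝ] ℝ) {c : ℝ}
    (hβ : ∀ v, β v = c) : wedge (rfl : 1 + 0 = 1 + 0) α β = c • α := by
  ext v
  change (((Nat.factorial 1 * Nat.factorial 0 : ℕ) : ℝ)⁻¹ •
    ContinuousMultilinearMap.alternatization (tensorForm α β)) v = c * α v
  rw [ContinuousAlternatingMap.smul_apply,
    ContinuousMultilinearMap.alternatization_apply_apply]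
  -- On a single argument the identity is the only permutation, so the alternating sum has one term.
  have huniv : (Finset.univ : Finset (Equiv.Perm (Fin (1 + 0)))) = {1} :=
    Finset.eq_singleton_iff_unique_mem.2 ⟨Finset.mem_univ _, fun s _ => Equiv.ext fun i =>
      Subsingleton.elim (α := Fin 1) _ _⟩
  have ht : tensorForm α β v = α v * c := by
    rw [← hβ fun j => v (Fin.natAdd 1 j)]
    rfl
  rw [huniv, Finset.sum_singleton]
  simp only [Equiv.Perm.coe_one, Function.comp_id, Equiv.Perm.sign_one, one_smul, ht]
  simp [mul_comm]

/-- The co-exterior product with a multiple of the volume form. -/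
theorem coext_smul_vol {d : ℕ} (g : T →L[ℝ] T →L[ℝ] ℝ) (η : T [⋀^Fin (d + 1)]→L[ℝ] ℝ)
    (b : Module.Basis (Fin (d + 1)) ℝ T) (hη : η b ^ 2 = |(gram g b).det|)
    (hg : (gram g b).det ≠ 0) (α : T [⋀^Fin d]→L[ℝ] ℝ) (c : ℝ) :
    coext (p' := 1) (q' := 0) (r := d) g η b rfl rfl rfl α (c • η) =
      (c * SignType.sign (gram g b).det) • α := by
  have hηb : η b ≠ 0 := by
    intro h0
    rw [h0] at hη
    exact hg (abs_eq_zero.1 (by simpa using hη.symm))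
  have hw := wedge_one_zero (hodge (q := 1) g η b rfl α)
    (hodge (q := 0) g η b rfl (c • η)) (c := c * SignType.sign (gram g b).det) (fun v => by
      rw [hodge_smul, ContinuousAlternatingMap.smul_apply, hodge_vol g η b hη, smul_eq_mul])
  -- The wedge is the star of a multiple of `α`, so it lies in the image of the star. Injectivity
  -- alone then makes `Function.invFun` return that multiple.
  rw [coext, hw, ← hodge_smul]
  exact Function.leftInverse_invFun (hodge_injective g η b hηb hg rfl) _

/-- Every form of top degree is a multiple of a given nonzero one. -/
theorem exists_eq_smul_of_top {n : ℕ} {η : T [⋀^Fin n]→L[ℝ] ℝ} (b : Module.Basis (Fin n) ℝ T)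
    (hη : η b ≠ 0) (β : T [⋀^Fin n]→L[ℝ] ℝ) : ∃ c : ℝ, β = c • η := by
  refine ⟨β b / η b, ContinuousAlternatingMap.toAlternatingMap_injective ?_⟩
  refine (AlternatingMap.eq_smul_basis_det b β.toAlternatingMap).trans ?_
  have h := AlternatingMap.eq_smul_basis_det b η.toAlternatingMap
  change _ = (β b / η b) • η.toAlternatingMap
  rw [h, smul_smul]
  congr 1
  exact (div_mul_cancel₀ _ hη).symm

/-- The Gram matrix of a nondegenerate bilinear form is invertible. -/
theorem det_gram_ne_zero {n : ℕ} (g : T →L[ℝ] T →L[ℝ] ℝ) (b : Module.Basis (Fin n) ℝ T)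
    (hg : ∀ v, (∀ w, g v w = 0) → v = 0) : (gram g b).det ≠ 0 := by
  intro h0
  -- A left null vector of the Gram matrix gives the coefficients of a vector orthogonal to every
  -- basis vector.
  obtain ⟨a, ha, hag⟩ := Matrix.exists_vecMul_eq_zero_iff.2 h0
  have hv : ∑ i, a i • b i = 0 := by
    refine hg _ fun w => ?_
    have : g (∑ i, a i • b i) = 0 := by
      apply ContinuousLinearMap.coe_injective
      refine b.ext fun j => ?_
      have := congrFun hag j
      simpa [Matrix.vecMul, dotProduct, gram] using this
    rw [this]
    rfl
  exact ha (funext fun i => Fintype.linearIndependent_iff.1 b.linearIndependent a hv i)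

/-- If the top-degree forms `β j i` sum up to the Kronecker delta times the volume form, then
co-exterior multiplication by them contracts to `± 1`. -/
theorem sum_coext_eq {ι : Type*} [DecidableEq ι] {d : ℕ} (g : T →L[ℝ] T →L[ℝ] ℝ)
    (η : T [⋀^Fin (d + 1)]→L[ℝ] ℝ) (b : Module.Basis (Fin (d + 1)) ℝ T)
    (hη : η b ^ 2 = |(gram g b).det|) (hg : (gram g b).det ≠ 0) (s : Finset ι)
    (α : ι → T [⋀^Fin d]→L[ℝ] ℝ) (β : ι → ι → T [⋀^Fin (d + 1)]→L[ℝ] ℝ) {k : ι} (hk : k ∈ s)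
    (hβ : ∀ i ∈ s, ∑ j ∈ s, β i j = if i = k then η else 0) :
    ∑ i ∈ s, ∑ j ∈ s, coext (p' := 1) (q' := 0) (r := d) g η b rfl rfl rfl (α i) (β i j) =
      ((SignType.sign (gram g b).det : ℤ) : ℝ) • α k := by
  have hηb : η b ≠ 0 := by
    intro h0
    rw [h0] at hη
    exact hg (abs_eq_zero.1 (by simpa using hη.symm))
  choose c hc using fun i j => exists_eq_smul_of_top b hηb (β i j)
  have hsum : ∀ i ∈ s, ∑ j ∈ s, c i j = if i = k then 1 else 0 := by
    intro i hi
    -- Evaluation at `b` and division by `η b` turn the identity of forms into one of scalars.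
    have h1 := congrArg (fun γ : T [⋀^Fin (d + 1)]→L[ℝ] ℝ => γ b) (hβ i hi)
    simp only [hc i, ← Finset.sum_smul] at h1
    refine mul_right_cancel₀ hηb (h1.trans ?_)
    split_ifs <;> simp
  have hinner : ∀ i ∈ s,
      ∑ j ∈ s, coext (p' := 1) (q' := 0) (r := d) g η b rfl rfl rfl (α i) (β i j) =
        if i = k then (SignType.sign (gram g b).det : ℝ) • α k else 0 := by
    intro i hi
    -- For fixed `i` all terms are multiples of the same `α i`, so the sum over `j` involves only
    -- the coefficients `c i j`.
    rw [Finset.sum_congr rfl fun j _ => by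
      rw [hc i j, coext_smul_vol g η b hη hg (α i) (c i j)], ← Finset.sum_smul, ← Finset.sum_mul,
      hsum i hi]
    split_ifs with h
    · rw [h, one_mul]
    · rw [zero_mul, zero_smul]
  rw [Finset.sum_congr rfl hinner, Finset.sum_ite_eq' s k, if_pos hk]
  simp

end Pointwise

end DeDonderWeyl

/-! ### Vanishing of the Dirac bracket on the constraint surface. -/

theorem proposition3p3 {d m : ℕ} {X Y : Type*}
    [TopologicalSpace X] [ChartedSpace (DeDonderWeyl.Base d) X]
    [IsManifold 𝓘(ℝ, DeDonderWeyl.Base d) ∞ X]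
    [TopologicalSpace Y] [ChartedSpace (DeDonderWeyl.Base d × DeDonderWeyl.Fib m) Y]
    [IsManifold 𝓘(ℝ, DeDonderWeyl.Base d × DeDonderWeyl.Fib m) ∞ Y]
    (S : DeDonderWeyl.SpaceTime d X) (P : DeDonderWeyl.FibredManifold d m X Y)
    {ι : Type*} [Fintype ι] (C : ι → DeDonderWeyl.HForm P d)
    (hC : ∀ i, DeDonderWeyl.IsHamiltonian (C i))
    (D : ι → ι → DeDonderWeyl.HForm P 1) (hD : DeDonderWeyl.IsInverseMatrix S C D)
    (F : DeDonderWeyl.HForm P d) (hF : DeDonderWeyl.IsHamiltonian F)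
    (k : ι) (hk : DeDonderWeyl.IsSecondClass C (C k)) :
    DeDonderWeyl.WeaklyZero C (DeDonderWeyl.diracBracket S C D F (C k)) := by
  classical
  intro z hz
  have hk' : k ∈ DeDonderWeyl.secondClass C := by simpa [DeDonderWeyl.secondClass] using hk
  have hg := DeDonderWeyl.det_gram_ne_zero (S.metric (P.toBase z))
    (DeDonderWeyl.tangentBasis (P.toBase z)) (S.nondegenerate (P.toBase z))
  have h := DeDonderWeyl.sum_coext_eq (S.metric (P.toBase z)) (S.vol (P.toBase z))
    (DeDonderWeyl.tangentBasis (P.toBase z)) (S.vol_sq _ _) hg (DeDonderWeyl.secondClass C)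
    (fun i => DeDonderWeyl.pgBracket F (C i) z)
    (fun i j => DeDonderWeyl.wedge (add_comm 1 d) (D i j z)
      (DeDonderWeyl.pgBracket (C j) (C k) z)) hk'
    (fun i hi => by convert hD z hz i hi k hk')
  rw [DeDonderWeyl.diracBracket, h, smul_smul, DeDonderWeyl.SpaceTime.sgn]
  -- The sign of the determinant now appears twice, once cast through `ℤ`; its square is `1` in
  -- either case, so the two terms cancel.
  rcases lt_or_gt_of_ne hg with h0 | h0
  · simp [sign_neg h0]
  · simp [sign_pos h0]
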